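/- Let $\Omega$ be the free $\mathbb{Z}$-module with basis $\{\xi_p\}$ indexed by the primes $p$, and let $\mathrm{d}:\mathbb{Z}\to\Omega$ be given by $\mathrm{d}0=0$ and $\mathrm{d}n=n\sum_{p\mid n}\frac{v_p(n)}{p}\,\xi_p$ for $n\neq 0$, where $v_p$ is the $p$-adic valuation. Let $\mathscr{T}$ be the $\mathbb{Z}$-module of group morphisms $\psi:\Omega\to\mathbb{Z}$ for which $\|\psi\|:=\sup_p|\psi(\xi_p)|$ is finite, and put $\mathrm{d}^\psi:=\psi\circ\mathrm{d}$. For positive integers $a,b$ let $\mathscr{T}(a,b)$ be the set of $\psi\in\mathscr{T}$ such that $\psi(\xi_p)=0$ for every prime $p\nmid ab(a+b)$ and $\mathrm{d}^\psi(a+b)=\mathrm{d}^\psi a+\mathrm{d}^\psi b$. The integers $a,b$ are called $\psi$-independent if $a\,\mathrm{d}^\psi b-b\,\mathrm{d}^\psi a\neq 0$. Write $\mathrm{rad}(n)$ for the product of the distinct primes dividing $n$. Consider the following conjectures. (Masser–Oesterlé $abc$ Conjecture) For every $\epsilon>0$ there is a constant $\kappa_\epsilon>0$ such that for all coprime positive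 integers $a,b,c$ with $a+b=c$ we have $c<\kappa_\epsilon\,\mathrm{rad}(abc)^{1+\epsilon}$. (Oesterlé's $abc$ Conjecture) There is an absolute constant $M$ such that for all coprime positive integers $a,b,c$ with $a+b=c$ we have $c<\mathrm{rad}(abc)^{M}$. (Small Derivatives Conjecture) There is an absolute constant $0<\eta<1$ such that for all but finitely many triples $(a,b,c)$ of coprime positive integers satisfying $a+b=c$ and not of the form $(1,N,q)$ with $q$ prime (up to order), there is $\psi\in\mathscr{T}(a,b)$ such that $a,b$ are $\psi$-independent and $\|\psi\|<c^{\eta}$. Then the Masser–Oesterlé $abc$ Conjecture implies the Small Derivatives Conjecture. Conversely, the Small Derivatives Conjecture implies Oesterlé's $abc$ Conjecture. -/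

import Mathlib

namespace SmallDerivatives

noncomputable section

/-- The type of prime numbers. -/
abbrev Primes : Type := {p : ℕ // p.Prime}

/-- The free `ℤ`-module on the variables `ξ_p`, one for each prime `p`. -/
abbrev Omega : Type := Primes →₀ ℤ

/-- The basis element `ξ_p`. -/
def xi (p : Primes) : Omega := Finsupp.single p 1

/-- The map `d : ℤ → Ω`, `d n = ∑_{p ∣ n} (n * v_p(n) / p) ξ_p` for `n ≠ 0` and `d 0 = 0`.
The division `n / p` is exact, since only primes dividing `n` occur in the sum
(for `n = 0` the sum is empty). -/
def d (n : ℤ) : Omega :=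
  ∑ p ∈ n.natAbs.primeFactors.attach,
    (n / ((p : ℕ) : ℤ) * (padicValInt (p : ℕ) n : ℤ)) •
      xi ⟨(p : ℕ), Nat.prime_of_mem_primeFactors p.2⟩

/-- The arithmetic derivative `d^ψ = ψ ∘ d` attached to `ψ`. -/
def arithDeriv (ψ : Omega →ₗ[ℤ] ℤ) (n : ℤ) : ℤ := ψ (d n)

/-- `‖ψ‖ = sup_p |ψ(ξ_p)|` is finite. -/
def HasFiniteNorm (ψ : Omega →ₗ[ℤ] ℤ) : Prop :=
  BddAbove (Set.range fun p : Primes => |((ψ (xi p) : ℤ) : ℝ)|)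

/-- The norm `‖ψ‖ = sup_p |ψ(ξ_p)|`, meaningful when `HasFiniteNorm ψ`. -/
def derivNorm (ψ : Omega →ₗ[ℤ] ℤ) : ℝ :=
  ⨆ p : Primes, |((ψ (xi p) : ℤ) : ℝ)|

/-- The `ℤ`-module `𝒯` of derivations: morphisms `Ω → ℤ` of finite norm. -/
def T : Submodule ℤ (Omega →ₗ[ℤ] ℤ) where
  carrier := {ψ | HasFiniteNorm ψ}
  zero_mem' := ⟨0, by rintro _ ⟨p, rfl⟩; simp⟩
  add_mem' := by
    rintro ψ φ ⟨A, hA⟩ ⟨B, hB⟩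
    refine ⟨A + B, ?_⟩
    rintro _ ⟨p, rfl⟩
    have h1 := hA ⟨p, rfl⟩
    have h2 := hB ⟨p, rfl⟩
    simp only [LinearMap.add_apply, Int.cast_add]
    exact (abs_add_le _ _).trans (add_le_add h1 h2)
  smul_mem' := by
    rintro k ψ ⟨A, hA⟩
    refine ⟨|(k : ℝ)| * A, ?_⟩
    rintro _ ⟨p, rfl⟩
    have h1 := hA ⟨p, rfl⟩
    simp only [LinearMap.smul_apply, smul_eq_mul, Int.cast_mul, abs_mul]
    exact mul_le_mul_of_nonneg_left h1 (abs_nonneg _)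

/-- The support of `ψ`: the primes `p` with `ψ(ξ_p) ≠ 0`. -/
def suppDeriv (ψ : Omega →ₗ[ℤ] ℤ) : Set Primes := {p | ψ (xi p) ≠ 0}

/-- The support of an integer: the primes dividing it. -/
def suppInt (n : ℤ) : Set Primes := {p | ((p : ℕ) : ℤ) ∣ n}

/-- The module `𝒯(a,b)` of derivations supported on the primes dividing `ab(a+b)` whose
arithmetic derivative satisfies `d^ψ(a+b) = d^ψ(a) + d^ψ(b)`. -/
def TPair (a b : ℤ) : Submodule ℤ (Omega →ₗ[ℤ] ℤ) where
  carrier := {ψ | ψ ∈ T ∧ suppDeriv ψ ⊆ suppInt (a * b * (a + b)) ∧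
    arithDeriv ψ (a + b) = arithDeriv ψ a + arithDeriv ψ b}
  zero_mem' := ⟨T.zero_mem, fun p hp => absurd rfl hp, by simp [arithDeriv]⟩
  add_mem' := by
    rintro ψ φ ⟨h1, h2, h3⟩ ⟨k1, k2, k3⟩
    refine ⟨T.add_mem h1 k1, fun p hp => ?_, ?_⟩
    · by_cases h : ψ (xi p) = 0
      · by_cases k : φ (xi p) = 0
        · exact absurd (by simp [h, k]) hp
        · exact k2 k
      · exact h2 h
    · simp only [arithDeriv, LinearMap.add_apply] at *
      rw [h3, k3]; ring
  smul_mem' := by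
    rintro k ψ ⟨h1, h2, h3⟩
    refine ⟨T.smul_mem k h1, fun p hp => h2 fun h => hp (by simp [h]), ?_⟩
    simp only [arithDeriv, LinearMap.smul_apply, smul_eq_mul] at *
    rw [h3]; ring

/-- The arithmetic Wronskian `W^ψ(a,b) = a d^ψ(b) - b d^ψ(a)`. -/
def wronskian (ψ : Omega →ₗ[ℤ] ℤ) (a b : ℤ) : ℤ :=
  a * arithDeriv ψ b - b * arithDeriv ψ a

/-- `a` and `b` are `ψ`-independent. -/
def Independent (ψ : Omega →ₗ[ℤ] ℤ) (a b : ℤ) : Prop := wronskian ψ a b ≠ 0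

/-- `(a,b,c)` is a triple of coprime positive integers with `a + b = c`
(because `a + b = c`, coprimality of `a, b` is the same as joint and as pairwise coprimality). -/
def IsABCTriple (a b c : ℕ) : Prop :=
  0 < a ∧ 0 < b ∧ 0 < c ∧ Nat.Coprime a b ∧ a + b = c

/-- Up to order, `(a,b,c)` is of the form `(1,N,q)` with `q` prime. -/
def IsOneNPrime (a b c : ℕ) : Prop :=
  ∃ N q : ℕ, q.Prime ∧ ({a, b, c} : Multiset ℕ) = {1, N, q}

/-- The Masser–Oesterlé `abc` conjecture. -/
def MasserOesterleABC : Prop :=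
  ∀ ε : ℝ, 0 < ε → ∃ κ : ℝ, 0 < κ ∧ ∀ a b c : ℕ, IsABCTriple a b c →
    (c : ℝ) < κ * ((UniqueFactorizationMonoid.radical (a * b * c : ℕ) : ℕ) : ℝ) ^ (1 + ε)

/-- Oesterlé's (weak) `abc` conjecture. -/
def OesterleABC : Prop :=
  ∃ M : ℝ, ∀ a b c : ℕ, IsABCTriple a b c →
    (c : ℝ) < ((UniqueFactorizationMonoid.radical (a * b * c : ℕ) : ℕ) : ℝ) ^ M

/-- The Small Derivatives Conjecture. -/
def SmallDerivativesConjecture : Prop :=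
  ∃ η : ℝ, 0 < η ∧ η < 1 ∧
    {t : ℕ × ℕ × ℕ | IsABCTriple t.1 t.2.1 t.2.2 ∧ ¬ IsOneNPrime t.1 t.2.1 t.2.2 ∧
      ¬ ∃ ψ ∈ TPair (t.1 : ℤ) (t.2.1 : ℤ),
        Independent ψ (t.1 : ℤ) (t.2.1 : ℤ) ∧ derivNorm ψ < (t.2.2 : ℝ) ^ η}.Finite

end

end SmallDerivatives

namespace SmallDerivatives

/-! Write D for `d^ψ`. Additivity on a + b = c makes the Wronskian W = a Db - b Da equal, up to
sign, to that of any two of a, b, c. Each n / rad n divides both n and Dn, so by coprimality abc /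
rad(abc) divides W. If W ≠ 0, comparison with |W| ≤ 2ab ‖ψ‖ log₂ c gives c ≤ 2 ‖ψ‖ log₂ c · rad(abc)
(`le_of_independent`). When ‖ψ‖ < c^η this bounds c by a power of the radical. For triples (1,N,q)
the radical already contains q ≥ c - 1, and the finitely many exceptions are absorbed by the
exponent, as the radical is at least 2.

For the other implication, additivity is one linear equation in the values x_p, so the pigeonhole
principle finds a nonzero solution in a box |x_p| < N_p with enough points. Dependence would force n
∣ Dn for each member n, hence p ∣ v_p x_p; so x_p = 0 wherever N_p ≤ p and p ∤ v_p. Only two primes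
p₀, p₁, in different members, may have longer sides. The third member then has derivative 0, and
dependence kills x_{p₀} and x_{p₁} too, a contradiction (`SignedTriple.hasSmallDeriv`).

If some prime exceeds about c^0.6, a box on three primes suffices; excluding (1,N,q) is what
supplies the other two. If all primes are at most c^0.6, the sides are taken to be the primes
themselves, lengthened by X ≈ c^0.25 at p₀ and p₁. Only there is abc needed: it makes the product of
the primes with p ∤ v_p at least a constant times c^0.8 (`MasserOesterleABC.exists_le_prod`). -/

/-! ### Derivatives in prime coordinates: divisibility and size -/

/-- The arithmetic derivative of a natural number `n` with prescribed values `x p` at the primes. -/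
def natDeriv (x : ℕ → ℤ) (n : ℕ) : ℤ :=
  ∑ p ∈ n.primeFactors, ((n / p * n.factorization p : ℕ) : ℤ) * x p

/-- The values of `ψ` at the primes, extended by zero. -/
noncomputable def primeValues (ψ : Omega →ₗ[ℤ] ℤ) (p : ℕ) : ℤ :=
  if h : p.Prime then ψ (xi ⟨p, h⟩) else 0

lemma arithDeriv_natCast (ψ : Omega →ₗ[ℤ] ℤ) (n : ℕ) :
    arithDeriv ψ (n : ℤ) = natDeriv (primeValues ψ) n := by
  unfold arithDeriv d natDeriv
  rw [map_sum]
  simp only [Int.natAbs_natCast]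
  rw [← Finset.sum_attach n.primeFactors
    (fun p => ((n / p * n.factorization p : ℕ) : ℤ) * primeValues ψ p)]
  refine Finset.sum_congr rfl fun p _ => ?_
  have hp := Nat.prime_of_mem_primeFactors p.2
  rw [map_smul, smul_eq_mul, primeValues, dif_pos hp, Nat.factorization_def _ hp]
  simp [padicValInt]

lemma exists_linearMap_primeValues (x : ℕ → ℤ) (hx : ∀ p, ¬ p.Prime → x p = 0) :
    ∃ ψ : Omega →ₗ[ℤ] ℤ, (∀ p : Primes, ψ (xi p) = x p) ∧ primeValues ψ = x := by
  have h : ∀ p : Primes, Finsupp.linearCombination ℤ (fun p : Primes => x p) (xi p) = x p := by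
    intro p
    simp [xi, Finsupp.linearCombination_single]
  refine ⟨_, h, ?_⟩
  funext p
  unfold primeValues
  split_ifs with hp
  · exact h ⟨p, hp⟩
  · exact (hx p hp).symm

lemma natDeriv_eq_sum_of_subset (x : ℕ → ℤ) {n : ℕ} {S : Finset ℕ} (h : n.primeFactors ⊆ S) :
    natDeriv x n = ∑ p ∈ S, ((n / p * n.factorization p : ℕ) : ℤ) * x p := by
  refine Finset.sum_subset h fun p _ hp => ?_
  have : n.factorization p = 0 := by
    rwa [← Nat.support_factorization, Finsupp.notMem_support_iff] at hp
  simp [this]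

/-- If `n` divides its derivative, then `p ∣ v_p(n) x_p` for each prime `p ∣ n`. -/
lemma dvd_of_dvd_natDeriv {x : ℕ → ℤ} {n p : ℕ} (hn : n ≠ 0) (hp : p.Prime) (hpn : p ∣ n)
    (h : (n : ℤ) ∣ natDeriv x n) : (p : ℤ) ∣ (n.factorization p : ℤ) * x p := by
  have hmem : p ∈ n.primeFactors := Nat.mem_primeFactors.2 ⟨hp, hpn, hn⟩
  obtain ⟨k, hk⟩ : ∃ k, n.factorization p = k + 1 :=
    Nat.exists_eq_succ_of_ne_zero (hp.factorization_pos_of_dvd hn hpn).ne'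
  have hpk : p ^ (k + 1) ∣ n := hk ▸ Nat.ordProj_dvd n p
  have hcop : ¬ p ∣ n / p ^ (k + 1) := hk ▸ Nat.not_dvd_ordCompl hp hn
  obtain ⟨m, hm⟩ := hpk
  have hm' : n / p ^ (k + 1) = m := by
    rw [hm]; exact Nat.mul_div_cancel_left _ (pow_pos hp.pos _)
  rw [hm'] at hcop
  have hnp : n / p = p ^ k * m := by
    rw [hm, pow_succ]
    exact Nat.div_eq_of_eq_mul_left hp.pos (by ring)
  unfold natDeriv at h
  rw [← Finset.add_sum_erase _ _ hmem] at h
  -- For q ≠ p the quotient n / q keeps the full power p^(k+1). Hence p^(k+1) also divides the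
  -- p-term, where n / p supplies only p^k.
  have h1 : ((p : ℤ) ^ (k + 1)) ∣ ∑ q ∈ n.primeFactors.erase p,
      ((n / q * n.factorization q : ℕ) : ℤ) * x q := by
    refine Finset.dvd_sum fun q hq => ?_
    obtain ⟨hqp, hq⟩ := Finset.mem_erase.1 hq
    have hq' := Nat.prime_of_mem_primeFactors hq
    have : p ^ (k + 1) ∣ n / q := by
      refine Nat.Coprime.dvd_of_dvd_mul_left (m := q) ?_ ?_
      · exact Nat.Coprime.pow_left _ ((Nat.coprime_primes hp hq').2 (Ne.symm hqp))
      · rw [Nat.mul_div_cancel' (Nat.dvd_of_mem_primeFactors hq)]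
        exact ⟨m, hm⟩
    refine Dvd.dvd.mul_right ?_ _
    exact_mod_cast this.mul_right _
  have h2 : ((p : ℤ) ^ (k + 1)) ∣ ((n / p * n.factorization p : ℕ) : ℤ) * x p := by
    refine (dvd_add_left h1).1 (dvd_trans ?_ h)
    exact_mod_cast (⟨m, hm⟩ : p ^ (k + 1) ∣ n)
  rw [hnp] at h2
  push_cast at h2
  have h3 : (p : ℤ) ^ k * p ∣ (p : ℤ) ^ k * (m * ((n.factorization p : ℤ) * x p)) := by
    convert h2 using 1 <;> ring
  have h4 := Int.dvd_of_mul_dvd_mul_left (pow_ne_zero k (by exact_mod_cast hp.ne_zero)) h3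
  rcases Int.Prime.dvd_mul' hp h4 with h5 | h5
  · exact absurd (by exact_mod_cast h5) hcop
  · exact h5

/-- Every prime is at least 2, so 2 to the sum of the exponents is at most n. -/
lemma sum_factorization_le_log {n : ℕ} (hn : n ≠ 0) (S : Finset ℕ) :
    ∑ p ∈ S, n.factorization p ≤ Nat.log 2 n := by
  have h1 : ∑ p ∈ S, n.factorization p ≤ ∑ p ∈ n.primeFactors, n.factorization p := by
    rw [← Finset.sum_filter_add_sum_filter_not S (· ∈ n.primeFactors)]
    rw [Finset.sum_eq_zero (s := S.filter (· ∉ n.primeFactors)), add_zero]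
    · refine Finset.sum_le_sum_of_subset fun p hp => (Finset.mem_filter.1 hp).2
    · intro p hp
      have := (Finset.mem_filter.1 hp).2
      rwa [← Nat.support_factorization, Finsupp.notMem_support_iff] at this
  refine h1.trans (Nat.le_log_of_pow_le one_lt_two ?_)
  rw [← Finset.prod_pow_eq_pow_sum]
  conv_rhs => rw [← Nat.prod_factorization_pow_eq_self hn]
  exact Finset.prod_le_prod' fun p hp =>
    Nat.pow_le_pow_left (Nat.prime_of_mem_primeFactors hp).two_le _

lemma abs_natDeriv_le {x : ℕ → ℤ} {n : ℕ} (hn : n ≠ 0) {B : ℝ} (hB : 0 ≤ B)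
    (hx : ∀ p, |(x p : ℝ)| ≤ B) : |(natDeriv x n : ℝ)| ≤ n * Nat.log 2 n * B := by
  unfold natDeriv
  push_cast
  calc _ ≤ ∑ p ∈ n.primeFactors, |((n / p : ℕ) : ℝ) * (n.factorization p) * (x p)| :=
        Finset.abs_sum_le_sum_abs _ _
    _ ≤ ∑ p ∈ n.primeFactors, (n : ℝ) * n.factorization p * B := by
        refine Finset.sum_le_sum fun p _ => ?_
        rw [abs_mul, abs_of_nonneg (by positivity)]
        gcongr
        · exact Nat.div_le_self _ _
        · exact hx p
    _ = n * ((∑ p ∈ n.primeFactors, n.factorization p : ℕ) : ℝ) * B := by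
        push_cast
        rw [Finset.mul_sum, Finset.sum_mul]
    _ ≤ _ := by
        gcongr
        exact sum_factorization_le_log hn _

/-- `n / rad n` divides the derivative of `n`. -/
lemma div_radical_dvd_natDeriv (x : ℕ → ℤ) (n : ℕ) :
    ((n / UniqueFactorizationMonoid.radical n : ℕ) : ℤ) ∣ natDeriv x n := by
  refine Finset.dvd_sum fun q hq => Dvd.dvd.mul_right ?_ _
  have h1 : q ∣ UniqueFactorizationMonoid.radical n := by
    rw [Nat.radical_eq_prod_primeFactors]
    exact Finset.dvd_prod_of_mem (fun p : ℕ => p) hq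
  have h2 : n / UniqueFactorizationMonoid.radical n ∣ n / q :=
    Nat.div_dvd_div_left UniqueFactorizationMonoid.radical_dvd_self h1
  exact_mod_cast h2.mul_right _

/-! ### Wronskian bound, and small derivatives imply Oesterlé's conjecture -/

open UniqueFactorizationMonoid Filter

lemma two_le_radical_of_abcTriple {a b c : ℕ} (h : IsABCTriple a b c) :
    2 ≤ radical (a * b * c) := by
  obtain ⟨ha, hb, hc, -, habc⟩ := h
  rw [Nat.two_le_radical_iff]
  have : 1 ≤ a * b := Nat.mul_pos ha hb
  nlinarith

lemma abcTriple_coprime {a b c : ℕ} (h : IsABCTriple a b c) :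
    Nat.Coprime a b ∧ Nat.Coprime a c ∧ Nat.Coprime b c := by
  obtain ⟨-, -, -, hab, rfl⟩ := h
  refine ⟨hab, ?_, ?_⟩
  · simpa using hab
  · simpa using hab.symm

lemma radical_abc_mul {a b c : ℕ} (h : IsABCTriple a b c) :
    radical (a * b * c) = radical a * radical b * radical c := by
  obtain ⟨h1, h2, h3⟩ := abcTriple_coprime h
  rw [radical_mul (Nat.coprime_iff_isRelPrime.1 (Nat.Coprime.mul_left h2 h3)),
    radical_mul (Nat.coprime_iff_isRelPrime.1 h1)]

/-- The product of the quotients `n / rad n` over an `abc` triple is at most the Wronskian. -/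
lemma prod_le_abs_wronskian_mul_radical {a b c : ℕ} (h : IsABCTriple a b c) {x : ℕ → ℤ}
    (hx : natDeriv x c = natDeriv x a + natDeriv x b)
    (hW : (a : ℤ) * natDeriv x b - b * natDeriv x a ≠ 0) :
    ((a * b * c : ℕ) : ℤ) ≤
      |(a : ℤ) * natDeriv x b - b * natDeriv x a| * (radical (a * b * c) : ℕ) := by
  obtain ⟨h1, h2, h3⟩ := abcTriple_coprime h
  have hrad := radical_abc_mul h
  have hdvd : ∀ n : ℕ, n / radical n ∣ n := fun n => Nat.div_dvd_of_dvd radical_dvd_self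
  have hmul : ∀ n : ℕ, n / radical n * radical n = n := fun n =>
    Nat.div_mul_cancel radical_dvd_self
  have hd : ∀ n : ℕ, ((n / radical n : ℕ) : ℤ) ∣ (n : ℤ) := fun n => by exact_mod_cast hdvd n
  set W := (a : ℤ) * natDeriv x b - b * natDeriv x a with hWdef
  have hc : (c : ℤ) = a + b := by exact_mod_cast h.2.2.2.2.symm
  -- In this form the divisibility by c / rad c becomes visible.
  have hWc : W = a * natDeriv x c - c * natDeriv x a := by rw [hx, hc, hWdef]; ring
  have hA : a / radical a ∣ W.natAbs := Int.natCast_dvd.1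
    (dvd_sub ((hd a).mul_right _) ((div_radical_dvd_natDeriv x a).mul_left _))
  have hB : b / radical b ∣ W.natAbs := Int.natCast_dvd.1
    (dvd_sub ((div_radical_dvd_natDeriv x b).mul_left _) ((hd b).mul_right _))
  have hC : c / radical c ∣ W.natAbs := Int.natCast_dvd.1 (hWc ▸
    (dvd_sub ((div_radical_dvd_natDeriv x c).mul_left _) ((hd c).mul_right _)))
  have hAB := Nat.Coprime.mul_dvd_of_dvd_of_dvd (h1.of_dvd (hdvd a) (hdvd b)) hA hB
  have hABC := Nat.Coprime.mul_dvd_of_dvd_of_dvd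
    (Nat.Coprime.mul_left (h2.of_dvd (hdvd a) (hdvd c)) (h3.of_dvd (hdvd b) (hdvd c))) hAB hC
  have hle := Nat.le_of_dvd (Int.natAbs_pos.2 hW) hABC
  have : a * b * c ≤ W.natAbs * radical (a * b * c) := by
    calc a * b * c = (a / radical a * (b / radical b) * (c / radical c)) *
          (radical a * radical b * radical c) := by
          conv_lhs => rw [← hmul a, ← hmul b, ← hmul c]
          ring
      _ ≤ _ := by rw [hrad]; gcongr
  rw [Int.abs_eq_natAbs]
  exact_mod_cast this

lemma derivNorm_nonneg (ψ : Omega →ₗ[ℤ] ℤ) : 0 ≤ derivNorm ψ :=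
  Real.iSup_nonneg fun _ => abs_nonneg _

lemma abs_primeValues_le_derivNorm {ψ : Omega →ₗ[ℤ] ℤ} (hψ : ψ ∈ T) (p : ℕ) :
    |(primeValues ψ p : ℝ)| ≤ derivNorm ψ := by
  unfold primeValues
  split_ifs with hp
  · exact le_ciSup (f := fun p : Primes => |((ψ (xi p) : ℤ) : ℝ)|) hψ ⟨p, hp⟩
  · simpa using derivNorm_nonneg ψ

/-- An independent derivation bounds `c` in terms of its norm and the radical. -/
lemma le_of_independent {a b c : ℕ} (h : IsABCTriple a b c) {ψ : Omega →ₗ[ℤ] ℤ}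
    (hψ : ψ ∈ TPair a b) (hind : Independent ψ a b) :
    (c : ℝ) ≤ 2 * Nat.log 2 c * derivNorm ψ * (radical (a * b * c) : ℕ) := by
  obtain ⟨hT, -, hadd⟩ := hψ
  have hc : (a : ℤ) + b = (c : ℕ) := by exact_mod_cast h.2.2.2.2
  rw [hc] at hadd
  simp only [Independent, wronskian] at hind
  simp only [arithDeriv_natCast] at hadd hind
  have key := prod_le_abs_wronskian_mul_radical h hadd hind
  obtain ⟨ha, hb, hc0, -, habc⟩ := h
  have hB := derivNorm_nonneg ψ
  have hda := abs_natDeriv_le ha.ne' hB (abs_primeValues_le_derivNorm hT)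
  have hdb := abs_natDeriv_le hb.ne' hB (abs_primeValues_le_derivNorm hT)
  have hla : (Nat.log 2 a : ℝ) ≤ Nat.log 2 c := by
    exact_mod_cast Nat.log_mono_right (show a ≤ c by omega)
  have hlb : (Nat.log 2 b : ℝ) ≤ Nat.log 2 c := by
    exact_mod_cast Nat.log_mono_right (show b ≤ c by omega)
  have key' : ((a * b * c : ℕ) : ℝ) ≤ |(a : ℝ) * natDeriv (primeValues ψ) b
      - b * natDeriv (primeValues ψ) a| * (radical (a * b * c) : ℕ) := by exact_mod_cast key
  have hW : |(a : ℝ) * natDeriv (primeValues ψ) b - b * natDeriv (primeValues ψ) a| ≤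
      a * b * (2 * Nat.log 2 c * derivNorm ψ) := by
    calc _ ≤ |(a : ℝ) * natDeriv (primeValues ψ) b| + |(b : ℝ) * natDeriv (primeValues ψ) a| :=
          abs_sub _ _
      _ ≤ a * (b * Nat.log 2 c * derivNorm ψ) + b * (a * Nat.log 2 c * derivNorm ψ) := by
          rw [abs_mul, abs_mul, Nat.abs_cast, Nat.abs_cast]
          gcongr
          · exact hdb.trans (by gcongr)
          · exact hda.trans (by gcongr)
      _ = _ := by ring
  have hab : (0 : ℝ) < a * b := by positivity
  refine le_of_mul_le_mul_left ?_ hab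
  calc (a * b : ℝ) * c = ((a * b * c : ℕ) : ℝ) := by push_cast; ring
    _ ≤ _ := key'
    _ ≤ (a * b * (2 * Nat.log 2 c * derivNorm ψ)) * (radical (a * b * c) : ℕ) := by gcongr
    _ = _ := by ring

lemma exists_log_le_rpow {δ : ℝ} (hδ : 0 < δ) :
    ∃ K : ℝ, 0 < K ∧ ∀ n : ℕ, (Nat.log 2 n : ℝ) ≤ K * (n : ℝ) ^ δ := by
  refine ⟨1 / δ / Real.log 2, by have := Real.log_pos one_lt_two; positivity, fun n => ?_⟩
  have h1 : (Nat.log 2 n : ℝ) ≤ Real.log n / Real.log 2 := by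
    simpa [Real.logb] using Real.natLog_le_logb n 2
  have h2 := Real.log_le_rpow_div (Nat.cast_nonneg n : (0 : ℝ) ≤ n) hδ
  have h3 := Real.log_pos one_lt_two
  calc _ ≤ _ := h1
    _ ≤ ((n : ℝ) ^ δ / δ) / Real.log 2 := by gcongr
    _ = _ := by ring

lemma le_radical_sq_of_isOneNPrime {a b c : ℕ} (h : IsABCTriple a b c)
    (h1 : IsOneNPrime a b c) : c ≤ radical (a * b * c) ^ 2 := by
  have hR := two_le_radical_of_abcTriple h
  obtain ⟨ha, hb, hc, -, habc⟩ := h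
  obtain ⟨N, q, hq, hm⟩ := h1
  -- Membership and the sum together replace a case split over permutations: since a + b + c = 2c,
  -- the case c = N gives c = q + 1.
  have hmem : ∀ y : ℕ, y = a ∨ y = b ∨ y = c ↔ y = 1 ∨ y = N ∨ y = q := by
    intro y
    have := congrArg (fun s => y ∈ s) hm
    simpa using this
  have hsum : a + b + c = 1 + N + q := by
    have := congrArg Multiset.sum hm
    simpa [add_assoc] using this
  have hqR : q ≤ radical (a * b * c) := by
    refine Nat.le_of_dvd (by omega) ?_
    have hne : a * b * c ≠ 0 := by positivity
    rw [Nat.radical_eq_prod_primeFactors]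
    refine Finset.dvd_prod_of_mem (fun p : ℕ => p) (Nat.mem_primeFactors.2 ⟨hq, ?_, hne⟩)
    rcases (hmem q).2 (by simp) with rfl | rfl | rfl
    · exact (dvd_mul_right _ _).mul_right _
    · exact (dvd_mul_left _ _).mul_right _
    · exact dvd_mul_left _ _
  have hcq : c ≤ q + 1 := by
    have := (hmem c).1 (by simp)
    omega
  nlinarith

/-- The Small Derivatives Conjecture implies Oesterlé's `abc` conjecture. -/
theorem oesterleABC_of_smallDerivatives (h : SmallDerivativesConjecture) : OesterleABC := by
  obtain ⟨η, hη0, hη1, hfin⟩ := h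
  obtain ⟨C, hC⟩ := (hfin.image fun t => t.2.2).bddAbove
  -- Here 1 = η + 2δ: one c^δ absorbs the logarithm and the other is left to be bounded by the
  -- radical.
  set δ := (1 - η) / 2 with hδdef
  have hδ : 0 < δ := by rw [hδdef]; linarith
  obtain ⟨K, hK0, hK⟩ := exists_log_le_rpow hδ
  obtain ⟨m, hm⟩ := pow_unbounded_of_one_lt (2 * K) (one_lt_two (α := ℝ))
  -- One exponent per case: triples (1,N,q), where c ≤ R²; exceptions, where c ≤ C < 2^C; and the
  -- main case, where 2K < 2^m ≤ R^m. The excess makes the inequality strict where it is needed.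
  refine ⟨max 3 (max (C + 1) (((m : ℝ) + 1) / δ + 1)), fun a b c habc => ?_⟩
  have hR2 : (2 : ℝ) ≤ (radical (a * b * c) : ℕ) := by
    exact_mod_cast two_le_radical_of_abcTriple habc
  set R : ℝ := ((radical (a * b * c) : ℕ) : ℝ) with hRdef
  have hR1 : 1 < R := by linarith
  by_cases h1 : IsOneNPrime a b c
  · have h2 : (c : ℝ) ≤ R ^ (2 : ℝ) := by
      rw [Real.rpow_two, hRdef]; exact_mod_cast le_radical_sq_of_isOneNPrime habc h1
    refine h2.trans_lt (Real.rpow_lt_rpow_of_exponent_lt hR1 ?_)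
    exact lt_of_lt_of_le (by norm_num) (le_max_left _ _)
  by_cases h2 : ∃ ψ ∈ TPair (a : ℤ) (b : ℤ), Independent ψ a b ∧ derivNorm ψ < (c : ℝ) ^ η
  · obtain ⟨ψ, hψ, hind, hnorm⟩ := h2
    have h3 := le_of_independent habc hψ hind
    have hc0 : (0 : ℝ) < c := by exact_mod_cast habc.2.2.1
    have h4 : (c : ℝ) ^ δ ≤ 2 * K * R := by
      have h5 : (c : ℝ) ≤ (c : ℝ) ^ δ * (c : ℝ) ^ η * (2 * K * R) := by
        calc (c : ℝ) ≤ _ := h3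
          _ ≤ 2 * (K * (c : ℝ) ^ δ) * (c : ℝ) ^ η * R := by
              have := derivNorm_nonneg ψ
              gcongr
              exact hK c
          _ = _ := by ring
      have h6 : (c : ℝ) = (c : ℝ) ^ δ * (c : ℝ) ^ η * (c : ℝ) ^ δ := by
        rw [← Real.rpow_add hc0, ← Real.rpow_add hc0]
        conv_lhs => rw [← Real.rpow_one (c : ℝ)]
        congr 1
        rw [hδdef]; ring
      refine le_of_mul_le_mul_left (a := (c : ℝ) ^ δ * (c : ℝ) ^ η) ?_ (by positivity)
      rwa [← h6]
    have h5 : (c : ℝ) ^ δ ≤ R ^ ((m : ℝ) + 1) := by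
      calc (c : ℝ) ^ δ ≤ 2 * K * R := h4
        _ ≤ R ^ m * R := by
            gcongr
            exact hm.le.trans (by gcongr)
        _ = _ := by
            rw [← pow_succ, ← Real.rpow_natCast]
            push_cast; rfl
    have h6 : (c : ℝ) ≤ R ^ (((m : ℝ) + 1) / δ) := by
      have := Real.rpow_le_rpow (by positivity) h5 (inv_nonneg.2 hδ.le)
      rwa [← Real.rpow_mul hc0.le, mul_inv_cancel₀ hδ.ne', Real.rpow_one,
        ← Real.rpow_mul (by linarith), ← div_eq_mul_inv] at this
    refine h6.trans_lt (Real.rpow_lt_rpow_of_exponent_lt hR1 ?_)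
    exact lt_of_lt_of_le (by linarith) ((le_max_right _ _).trans (le_max_right _ _))
  · have h3 : c ≤ C := hC ⟨(a, b, c), ⟨habc, h1, h2⟩, rfl⟩
    have h4 : (c : ℝ) < R ^ ((C : ℝ) + 1) := by
      calc (c : ℝ) ≤ C := by exact_mod_cast h3
        _ < (2 : ℝ) ^ C := by exact_mod_cast Nat.lt_two_pow_self
        _ ≤ R ^ C := by gcongr
        _ = R ^ (C : ℝ) := (Real.rpow_natCast _ _).symm
        _ ≤ _ := Real.rpow_le_rpow_of_exponent_le hR1.le (by linarith)
    refine h4.trans_le (Real.rpow_le_rpow_of_exponent_le hR1.le ?_)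
    exact (le_max_left _ _).trans (le_max_right _ _)

/-! ### Pigeonhole construction of independent derivations -/

/-- Siegel's lemma for one linear form and a box with arbitrary side lengths. -/
lemma exists_ne_zero_sum_mul_eq_zero (S : Finset ℕ) (w : ℕ → ℤ) (N : ℕ → ℕ) (M : ℕ)
    (hM : ∑ p ∈ S, |w p| * N p ≤ M) (hcard : 2 * M + 1 < ∏ p ∈ S, N p) :
    ∃ z : ℕ → ℤ, (∀ p ∉ S, z p = 0) ∧ (∀ p ∈ S, |z p| < N p) ∧ z ≠ 0 ∧
      ∑ p ∈ S, w p * z p = 0 := by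
  classical
  -- The form takes at most 2M + 1 values on the box, so two points share one; their difference is
  -- the solution, with entries strictly below the sides.
  let f : ((p : S) → Fin (N p)) → ℤ := fun x => ∑ p : S, w p * ((x p : ℕ) : ℤ)
  have hf : ∀ x, f x ∈ Finset.Icc (-(M : ℤ)) M := by
    intro x
    rw [Finset.mem_Icc, ← abs_le]
    refine (Finset.abs_sum_le_sum_abs _ _).trans (le_trans ?_ hM)
    rw [← Finset.sum_coe_sort S (fun p => |w p| * (N p : ℤ))]
    refine Finset.sum_le_sum fun p _ => ?_
    rw [abs_mul, Nat.abs_cast]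
    gcongr
    exact (x p).2.le
  have hlt : (Finset.Icc (-(M : ℤ)) M).card <
      (Finset.univ : Finset ((p : S) → Fin (N p))).card := by
    rw [Finset.card_univ, Fintype.card_pi, Int.card_Icc]
    simp only [Fintype.card_fin]
    rw [Finset.prod_coe_sort S N]
    omega
  obtain ⟨x, -, y, -, hxy, hfxy⟩ :=
    Finset.exists_ne_map_eq_of_card_lt_of_maps_to hlt (fun x _ => hf x)
  let z : ℕ → ℤ := fun p => if h : p ∈ S then ((x ⟨p, h⟩ : ℕ) : ℤ) - ((y ⟨p, h⟩ : ℕ) : ℤ) else 0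
  have hz : ∀ p : S, z p = ((x p : ℕ) : ℤ) - ((y p : ℕ) : ℤ) := fun p => by simp [z]
  refine ⟨z, fun p hp => by simp [z, hp], fun p hp => ?_, fun h0 => hxy ?_, ?_⟩
  · have h1 := hz ⟨p, hp⟩
    have h2 := (x ⟨p, hp⟩).2
    have h3 := (y ⟨p, hp⟩).2
    simp only at h1 h2 h3
    rw [h1, abs_lt]
    omega
  · funext p
    have h1 := hz p
    rw [h0, Pi.zero_apply] at h1
    apply Fin.ext
    omega
  · rw [← Finset.sum_coe_sort S (fun p => w p * z p)]
    simp only [hz, mul_sub, Finset.sum_sub_distrib]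
    exact sub_eq_zero.2 hfxy

/-- Up to signs `e`, there is a derivation of norm at most `Y` that is compatible with a relation
between `n₀, n₁, n₂` and for which `n₀, n₁` are independent. -/
def HasSmallDeriv (n₀ n₁ n₂ : ℕ) (e₀ e₁ e₂ : ℤ) (Y : ℕ) : Prop :=
  ∃ x : ℕ → ℤ, (∀ p, p ∉ (n₀ * n₁ * n₂).primeFactors → x p = 0) ∧ (∀ p, |x p| ≤ Y) ∧
    e₀ * natDeriv x n₀ + e₁ * natDeriv x n₁ + e₂ * natDeriv x n₂ = 0 ∧
    (n₀ : ℤ) * natDeriv x n₁ ≠ n₁ * natDeriv x n₀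

/-- A signed relation `± n₀ ± n₁ ± n₂ = 0` between pairwise coprime positive integers. -/
structure SignedTriple (n₀ n₁ n₂ : ℕ) (e₀ e₁ e₂ : ℤ) : Prop where
  pos₀ : n₀ ≠ 0
  pos₁ : n₁ ≠ 0
  pos₂ : n₂ ≠ 0
  cop₀₁ : n₀.Coprime n₁
  cop₀₂ : n₀.Coprime n₂
  cop₁₂ : n₁.Coprime n₂
  sign₀ : |e₀| = 1
  sign₁ : |e₁| = 1
  sign₂ : |e₂| = 1
  rel : e₀ * n₀ + e₁ * n₁ + e₂ * n₂ = 0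

section

variable {n₀ n₁ n₂ : ℕ} {e₀ e₁ e₂ : ℤ}

lemma SignedTriple.swap (h : SignedTriple n₀ n₁ n₂ e₀ e₁ e₂) :
    SignedTriple n₁ n₀ n₂ e₁ e₀ e₂ where
  pos₀ := h.pos₁
  pos₁ := h.pos₀
  pos₂ := h.pos₂
  cop₀₁ := h.cop₀₁.symm
  cop₀₂ := h.cop₁₂
  cop₁₂ := h.cop₀₂
  sign₀ := h.sign₁
  sign₁ := h.sign₀
  sign₂ := h.sign₂
  rel := by linarith [h.rel]

lemma SignedTriple.rotate (h : SignedTriple n₀ n₁ n₂ e₀ e₁ e₂) :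
    SignedTriple n₁ n₂ n₀ e₁ e₂ e₀ where
  pos₀ := h.pos₁
  pos₁ := h.pos₂
  pos₂ := h.pos₀
  cop₀₁ := h.cop₁₂
  cop₀₂ := h.cop₀₁.symm
  cop₁₂ := h.cop₀₂.symm
  sign₀ := h.sign₁
  sign₁ := h.sign₂
  sign₂ := h.sign₀
  rel := by linarith [h.rel]

/-- Dependence of the first two members of a signed triple propagates to all pairs. -/
lemma SignedTriple.dependent_rotate (h : SignedTriple n₀ n₁ n₂ e₀ e₁ e₂) {x : ℕ → ℤ}
    (hx : e₀ * natDeriv x n₀ + e₁ * natDeriv x n₁ + e₂ * natDeriv x n₂ = 0)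
    (hd : (n₀ : ℤ) * natDeriv x n₁ = n₁ * natDeriv x n₀) :
    (n₁ : ℤ) * natDeriv x n₂ = n₂ * natDeriv x n₁ := by
  have he : e₂ ≠ 0 := by intro h0; have := h.sign₂; simp [h0] at this
  refine mul_left_cancel₀ he ?_
  linear_combination (n₁ : ℤ) * hx - natDeriv x n₁ * h.rel + e₀ * hd

lemma HasSmallDeriv.swap {Y : ℕ} (h : HasSmallDeriv n₀ n₁ n₂ e₀ e₁ e₂ Y) :
    HasSmallDeriv n₁ n₀ n₂ e₁ e₀ e₂ Y := by
  obtain ⟨x, h1, h2, h3, h4⟩ := h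
  exact ⟨x, by rwa [mul_comm n₁ n₀], h2, by linarith, h4.symm⟩

/-- Allowing signs makes the three members interchangeable, so the two distinguished primes may come
from any two of them. -/
lemma HasSmallDeriv.rotate {Y : ℕ} (ht : SignedTriple n₀ n₁ n₂ e₀ e₁ e₂)
    (h : HasSmallDeriv n₀ n₁ n₂ e₀ e₁ e₂ Y) :
    HasSmallDeriv n₁ n₂ n₀ e₁ e₂ e₀ Y := by
  obtain ⟨x, h1, h2, h3, h4⟩ := h
  refine ⟨x, ?_, h2, by linarith, fun h5 => h4 ?_⟩
  · rwa [show n₁ * n₂ * n₀ = n₀ * n₁ * n₂ by ring]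
  · have h6 := ht.rotate.dependent_rotate (by linarith) h5
    exact ht.rotate.rotate.dependent_rotate (by linarith) h6

lemma SignedTriple.factorization_eq (h : SignedTriple n₀ n₁ n₂ e₀ e₁ e₂) {p : ℕ}
    (hp : p.Prime) (hpn : p ∣ n₀) :
    (n₀ * n₁ * n₂).factorization p = n₀.factorization p := by
  have h1 : ¬ p ∣ n₁ := fun h1 => Nat.not_coprime_of_dvd_of_dvd hp.one_lt hpn h1 h.cop₀₁
  have h2 : ¬ p ∣ n₂ := fun h2 => Nat.not_coprime_of_dvd_of_dvd hp.one_lt hpn h2 h.cop₀₂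
  rw [Nat.factorization_mul (mul_ne_zero h.pos₀ h.pos₁) h.pos₂,
    Nat.factorization_mul h.pos₀ h.pos₁]
  simp [Nat.factorization_eq_zero_of_not_dvd h1, Nat.factorization_eq_zero_of_not_dvd h2]

/-- Under dependence, `p ∣ x_p` for primes `p ∣ n₀` not dividing their own exponent. -/
lemma SignedTriple.dvd_of_dependent (h : SignedTriple n₀ n₁ n₂ e₀ e₁ e₂) {x : ℕ → ℤ}
    (hd : (n₀ : ℤ) * natDeriv x n₁ = n₁ * natDeriv x n₀) {p : ℕ} (hp : p.Prime) (hpn : p ∣ n₀)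
    (hv : ¬ p ∣ (n₀ * n₁ * n₂).factorization p) : (p : ℤ) ∣ x p := by
  rw [h.factorization_eq hp hpn] at hv
  have h1 : (n₀ : ℤ) ∣ natDeriv x n₀ := by
    refine IsCoprime.dvd_of_dvd_mul_left (Nat.isCoprime_iff_coprime.2 h.cop₀₁) ?_
    exact ⟨_, hd.symm⟩
  rcases Int.Prime.dvd_mul' hp (dvd_of_dvd_natDeriv h.pos₀ hp hpn h1) with h2 | h2
  · exact absurd (by exact_mod_cast h2) hv
  · exact h2

lemma natDeriv_eq_zero {x : ℕ → ℤ} {n : ℕ} (h : ∀ p ∈ n.primeFactors, x p = 0) :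
    natDeriv x n = 0 :=
  Finset.sum_eq_zero fun p hp => by rw [h p hp, mul_zero]

lemma eq_zero_of_natDeriv_eq_zero {x : ℕ → ℤ} {n p : ℕ} (hn : n ≠ 0) (hp : p.Prime)
    (hpn : p ∣ n) (h : ∀ q ∈ n.primeFactors, q ≠ p → x q = 0) (h0 : natDeriv x n = 0) :
    x p = 0 := by
  have hmem : p ∈ n.primeFactors := Nat.mem_primeFactors.2 ⟨hp, hpn, hn⟩
  unfold natDeriv at h0
  rw [Finset.sum_eq_single_of_mem p hmem fun q hq hqp => by rw [h q hq hqp, mul_zero]] at h0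
  rcases mul_eq_zero.1 h0 with h1 | h1
  · have h2 : 0 < n / p := Nat.div_pos (Nat.le_of_dvd (Nat.pos_of_ne_zero hn) hpn) hp.pos
    have h3 := hp.factorization_pos_of_dvd hn hpn
    have h4 := Nat.mul_pos h2 h3
    omega
  · exact h1

/-- The counting argument: a box with more points than values of the linear form contains an
independent derivation. -/
lemma SignedTriple.hasSmallDeriv (h : SignedTriple n₀ n₁ n₂ e₀ e₁ e₂) {p₀ p₁ C X Y : ℕ}
    (hp₀ : p₀.Prime) (hp₁ : p₁.Prime) (hd₀ : p₀ ∣ n₀) (hd₁ : p₁ ∣ n₁)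
    (hC₀ : n₀ ≤ C) (hC₁ : n₁ ≤ C) (hC₂ : n₂ ≤ C) (N : ℕ → ℕ)
    (hNX : ∀ p ∈ (n₀ * n₁ * n₂).primeFactors, N p ≤ p * X)
    (hNY : ∀ p ∈ (n₀ * n₁ * n₂).primeFactors, N p ≤ Y)
    (hN : ∀ p ∈ (n₀ * n₁ * n₂).primeFactors, p ≠ p₀ → p ≠ p₁ →
      N p = 1 ∨ (N p ≤ p ∧ ¬ p ∣ (n₀ * n₁ * n₂).factorization p))
    (hcard : 2 * (C * X * Nat.log 2 (n₀ * n₁ * n₂)) + 1 <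
      ∏ p ∈ (n₀ * n₁ * n₂).primeFactors, N p) :
    HasSmallDeriv n₀ n₁ n₂ e₀ e₁ e₂ Y := by
  set n := n₀ * n₁ * n₂ with hn
  have hn0 : n ≠ 0 := mul_ne_zero (mul_ne_zero h.pos₀ h.pos₁) h.pos₂
  have hs₀ : n₀.primeFactors ⊆ n.primeFactors :=
    Nat.primeFactors_mono ((dvd_mul_right _ _).mul_right _) hn0
  have hs₁ : n₁.primeFactors ⊆ n.primeFactors :=
    Nat.primeFactors_mono ((dvd_mul_left _ _).mul_right _) hn0
  have hs₂ : n₂.primeFactors ⊆ n.primeFactors :=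
    Nat.primeFactors_mono (dvd_mul_left _ _) hn0
  have hfac : ∀ p, n.factorization p =
      n₀.factorization p + n₁.factorization p + n₂.factorization p := by
    intro p
    rw [hn, Nat.factorization_mul (mul_ne_zero h.pos₀ h.pos₁) h.pos₂,
      Nat.factorization_mul h.pos₀ h.pos₁]
    rfl
  let w : ℕ → ℤ := fun p => e₀ * ((n₀ / p * n₀.factorization p : ℕ) : ℤ)
    + e₁ * ((n₁ / p * n₁.factorization p : ℕ) : ℤ) + e₂ * ((n₂ / p * n₂.factorization p : ℕ) : ℤ)
  -- The bound N p ≤ p * X cancels the division by p in the coefficient, leaving C * X times the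
  -- exponent; the exponents sum to at most log₂ n.
  have hterm : ∀ {e : ℤ} {m p : ℕ}, |e| = 1 → m ≤ C → p ∈ n.primeFactors →
      |e * ((m / p * m.factorization p : ℕ) : ℤ)| * N p ≤ (C * X * m.factorization p : ℕ) := by
    intro e m p he hm hp
    rw [abs_mul, he, one_mul, Nat.abs_cast]
    norm_cast
    calc m / p * m.factorization p * N p ≤ m / p * m.factorization p * (p * X) := by
          gcongr; exact hNX p hp
      _ = m / p * p * X * m.factorization p := by ring
      _ ≤ C * X * m.factorization p := by
          gcongr
          exact (Nat.div_mul_le_self _ _).trans hm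
  have hM : ∑ p ∈ n.primeFactors, |w p| * N p ≤ (C * X * Nat.log 2 n : ℕ) := by
    calc ∑ p ∈ n.primeFactors, |w p| * N p
        ≤ ∑ p ∈ n.primeFactors, ((C * X * n.factorization p : ℕ) : ℤ) := by
          refine Finset.sum_le_sum fun p hp => ?_
          have h0 := hterm h.sign₀ hC₀ hp
          have h1 := hterm h.sign₁ hC₁ hp
          have h2 := hterm h.sign₂ hC₂ hp
          rw [hfac p, mul_add, mul_add, Nat.cast_add, Nat.cast_add]
          refine le_trans ?_ (add_le_add (add_le_add h0 h1) h2)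
          rw [← add_mul, ← add_mul]
          gcongr
          exact abs_add_three _ _ _
      _ = ((C * X * ∑ p ∈ n.primeFactors, n.factorization p : ℕ) : ℤ) := by
          rw [← Nat.cast_sum, Finset.mul_sum]
      _ ≤ _ := by
          gcongr
          exact sum_factorization_le_log hn0 _
  obtain ⟨x, hx0, hxN, hxne, hxw⟩ := exists_ne_zero_sum_mul_eq_zero _ w N _ hM hcard
  have hrel : e₀ * natDeriv x n₀ + e₁ * natDeriv x n₁ + e₂ * natDeriv x n₂ = 0 := by
    rw [natDeriv_eq_sum_of_subset x hs₀, natDeriv_eq_sum_of_subset x hs₁,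
      natDeriv_eq_sum_of_subset x hs₂, Finset.mul_sum, Finset.mul_sum, Finset.mul_sum,
      ← Finset.sum_add_distrib, ← Finset.sum_add_distrib, ← hxw]
    exact Finset.sum_congr rfl fun p _ => by simp only [w]; ring
  refine ⟨x, hx0, fun p => ?_, hrel, fun hdep => hxne ?_⟩
  · by_cases hp : p ∈ n.primeFactors
    · exact (hxN p hp).le.trans (by exact_mod_cast hNY p hp)
    · simp [hx0 p hp]
  have hdep₁ := h.dependent_rotate hrel hdep
  have hdep₂ := h.rotate.dependent_rotate (by linarith) hdep₁
  -- A side of length 1 leaves only 0; otherwise dependence gives p ∣ x p while |x p| < p.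
  have hoff : ∀ p, p ≠ p₀ → p ≠ p₁ → x p = 0 := by
    intro p hp0 hp1
    by_cases hp : p ∈ n.primeFactors
    · have hlt := hxN p hp
      rcases hN p hp hp0 hp1 with h1 | ⟨h1, h2⟩
      · rw [h1] at hlt
        exact Int.abs_lt_one_iff.1 (by exact_mod_cast hlt)
      · have hpp := Nat.prime_of_mem_primeFactors hp
        have hdvd : (p : ℤ) ∣ x p := by
          have hpn := Nat.dvd_of_mem_primeFactors hp
          rcases (hpp.dvd_mul).1 hpn with h3 | h3
          · rcases (hpp.dvd_mul).1 h3 with h3 | h3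
            · exact h.dvd_of_dependent hdep hpp h3 h2
            · refine h.rotate.dvd_of_dependent hdep₁ hpp h3 ?_
              rwa [show n₁ * n₂ * n₀ = n by rw [hn]; ring]
          · refine h.rotate.rotate.dvd_of_dependent hdep₂ hpp h3 ?_
            rwa [show n₂ * n₀ * n₁ = n by rw [hn]; ring]
        refine Int.eq_zero_of_abs_lt_dvd hdvd (hlt.trans_le (by exact_mod_cast h1))
    · exact hx0 p hp
  have hne : ∀ {p m m' : ℕ}, p.Prime → p ∣ m → m.Coprime m' → ∀ q ∈ m'.primeFactors, q ≠ p := by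
    rintro p m m' hp hpm hmm q hq rfl
    exact Nat.not_coprime_of_dvd_of_dvd hp.one_lt hpm (Nat.dvd_of_mem_primeFactors hq) hmm
  -- Neither p₀ nor p₁ divides n₂. Dependence then carries the vanishing to n₁ and n₀, whose
  -- derivatives reduce to a single term with nonzero coefficient.
  have hD₂ : natDeriv x n₂ = 0 := natDeriv_eq_zero fun p hp =>
    hoff p (hne hp₀ hd₀ h.cop₀₂ p hp) (hne hp₁ hd₁ h.cop₁₂ p hp)
  have hD₁ : natDeriv x n₁ = 0 := by
    rw [hD₂, mul_zero] at hdep₁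
    exact (mul_eq_zero.1 hdep₁.symm).resolve_left (by exact_mod_cast h.pos₂)
  have hD₀ : natDeriv x n₀ = 0 := by
    rw [hD₂, mul_zero] at hdep₂
    exact (mul_eq_zero.1 hdep₂).resolve_left (by exact_mod_cast h.pos₂)
  funext p
  by_cases hp0 : p = p₀
  · rw [hp0]
    exact eq_zero_of_natDeriv_eq_zero h.pos₀ hp₀ hd₀
      (fun q hq hq0 => hoff q hq0 (hne hp₁ hd₁ h.cop₀₁.symm q hq)) hD₀
  by_cases hp1 : p = p₁
  · rw [hp1]
    exact eq_zero_of_natDeriv_eq_zero h.pos₁ hp₁ hd₁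
      (fun q hq hq1 => hoff q (hne hp₀ hd₀ h.cop₀₁ q hq) hq1) hD₁
  · exact hoff p hp0 hp1

end

/-! ### Two regimes: a large prime, or only small primes -/

section

variable {n₀ n₁ n₂ : ℕ} {e₀ e₁ e₂ : ℤ}

/-- The box has side Y at q, p₀, p₁ and side 1 elsewhere: Y³ points against about C·Y·log values,
hence the condition on Y². -/
lemma SignedTriple.hasSmallDeriv_of_three_primes (h : SignedTriple n₀ n₁ n₂ e₀ e₁ e₂)
    {q p₀ p₁ C Y : ℕ} (hq : q.Prime) (hp₀ : p₀.Prime) (hp₁ : p₁.Prime)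
    (hqd : q ∣ n₀ * n₁ * n₂) (hd₀ : p₀ ∣ n₀) (hd₁ : p₁ ∣ n₁) (hq₀ : q ≠ p₀) (hq₁ : q ≠ p₁)
    (hv : ¬ q ∣ (n₀ * n₁ * n₂).factorization q)
    (hC₀ : n₀ ≤ C) (hC₁ : n₁ ≤ C) (hC₂ : n₂ ≤ C) (hY : 1 ≤ Y) (hYq : Y ≤ q)
    (hcard : 2 * (C * Nat.log 2 (n₀ * n₁ * n₂)) + 1 < Y ^ 2) :
    HasSmallDeriv n₀ n₁ n₂ e₀ e₁ e₂ Y := by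
  have hn0 : n₀ * n₁ * n₂ ≠ 0 := mul_ne_zero (mul_ne_zero h.pos₀ h.pos₁) h.pos₂
  have h01 : p₀ ≠ p₁ := by
    rintro rfl
    exact Nat.not_coprime_of_dvd_of_dvd hp₀.one_lt hd₀ hd₁ h.cop₀₁
  let N : ℕ → ℕ := fun p => if p = q ∨ p = p₀ ∨ p = p₁ then Y else 1
  have hNY : ∀ p, N p ≤ Y := fun p => by simp only [N]; split_ifs <;> omega
  have hN1 : ∀ p, 1 ≤ N p := fun p => by simp only [N]; split_ifs <;> omega
  refine h.hasSmallDeriv hp₀ hp₁ hd₀ hd₁ hC₀ hC₁ hC₂ (X := Y) N (fun p hp => ?_)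
    (fun p _ => hNY p) (fun p hp hp0 hp1 => ?_) ?_
  · exact (hNY p).trans (Nat.le_mul_of_pos_left _ (Nat.prime_of_mem_primeFactors hp).pos)
  · by_cases hpq : p = q
    · subst hpq
      exact Or.inr ⟨(hNY p).trans hYq, hv⟩
    · left
      simp [N, hpq, hp0, hp1]
  · have hsub : ({q, p₀, p₁} : Finset ℕ) ⊆ (n₀ * n₁ * n₂).primeFactors := by
      intro p hp
      simp only [Finset.mem_insert, Finset.mem_singleton] at hp
      rcases hp with rfl | rfl | rfl
      · exact Nat.mem_primeFactors.2 ⟨hq, hqd, hn0⟩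
      · exact Nat.mem_primeFactors.2 ⟨hp₀, (hd₀.mul_right _).mul_right _, hn0⟩
      · exact Nat.mem_primeFactors.2 ⟨hp₁, (hd₁.mul_left _).mul_right _, hn0⟩
    have h3 : ∏ p ∈ ({q, p₀, p₁} : Finset ℕ), N p = Y ^ 3 := by
      rw [Finset.prod_insert (by simp [hq₀, hq₁]), Finset.prod_insert (by simp [h01]),
        Finset.prod_singleton]
      simp [N]
      ring
    calc 2 * (C * Y * Nat.log 2 (n₀ * n₁ * n₂)) + 1
        ≤ (2 * (C * Nat.log 2 (n₀ * n₁ * n₂)) + 1) * Y := by nlinarith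
      _ < Y ^ 2 * Y := by gcongr
      _ = ∏ p ∈ ({q, p₀, p₁} : Finset ℕ), N p := by rw [h3]; ring
      _ ≤ _ := Finset.prod_le_prod_of_subset_of_one_le' hsub fun p _ _ => hN1 p

/-- The case where `n₀` has a large prime factor. -/
lemma SignedTriple.hasSmallDeriv_of_large_prime (h : SignedTriple n₀ n₁ n₂ e₀ e₁ e₂)
    {q C Y : ℕ} (hq : q.Prime) (hqd : q ∣ n₀) (hC₀ : n₀ ≤ C) (hC₁ : n₁ ≤ C) (hC₂ : n₂ ≤ C)
    (hCq : C < q ^ 2) (hY : 1 ≤ Y) (hYq : Y ≤ q)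
    (hcard : 2 * (C * Nat.log 2 (n₀ * n₁ * n₂)) + 1 < Y ^ 2)
    (hne : ¬ (n₁ = 1 ∧ n₂ = 1)) (hne' : ¬ (n₀ = q ∧ (n₁ = 1 ∨ n₂ = 1))) :
    HasSmallDeriv n₀ n₁ n₂ e₀ e₁ e₂ Y := by
  -- Since n₀ ≤ C < q², the exponent of q is exactly 1, which q does not divide.
  have hsq : ¬ q ^ 2 ∣ n₀ := fun hd => by
    have := Nat.le_of_dvd (Nat.pos_of_ne_zero h.pos₀) hd
    omega
  have hv : ¬ q ∣ (n₀ * n₁ * n₂).factorization q := by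
    rw [h.factorization_eq hq hqd]
    have h1 := hq.factorization_pos_of_dvd h.pos₀ hqd
    have h2 : n₀.factorization q < 2 := by
      by_contra! h2
      exact hsq ((hq.pow_dvd_iff_le_factorization h.pos₀).2 h2)
    have h3 : n₀.factorization q = 1 := by omega
    rw [h3]
    exact hq.one_lt.ne' ∘ Nat.dvd_one.1
  have hne₁ : ∀ {p}, p.Prime → p ∣ n₁ → q ≠ p := by
    rintro p hp hd rfl
    exact Nat.not_coprime_of_dvd_of_dvd hp.one_lt hqd hd h.cop₀₁
  have hne₂ : ∀ {p}, p.Prime → p ∣ n₂ → q ≠ p := by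
    rintro p hp hd rfl
    exact Nat.not_coprime_of_dvd_of_dvd hp.one_lt hqd hd h.cop₀₂
  have hqn : q ∣ n₀ * n₁ * n₂ := (hqd.mul_right _).mul_right _
  have hr : n₁ * n₂ * n₀ = n₀ * n₁ * n₂ := by ring
  -- If n₀ = q, the auxiliary primes must come from n₁ and n₂, both different from 1 by the
  -- hypotheses. Otherwise n₀ / q supplies one, and whichever of n₁, n₂ is not 1 supplies the other.
  by_cases h0 : n₀ = q
  · obtain ⟨p₁, hp₁, hd₁⟩ := Nat.exists_prime_and_dvd (n := n₁) (by tauto)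
    obtain ⟨p₂, hp₂, hd₂⟩ := Nat.exists_prime_and_dvd (n := n₂) (by tauto)
    have := h.rotate.hasSmallDeriv_of_three_primes hq hp₁ hp₂ (hr ▸ hqn) hd₁ hd₂ (hne₁ hp₁ hd₁)
      (hne₂ hp₂ hd₂) (by rwa [hr]) hC₁ hC₂ hC₀ hY hYq (by rwa [hr])
    exact (this.rotate h.rotate).rotate h.rotate.rotate
  · obtain ⟨m, hm⟩ := hqd
    obtain ⟨p₀, hp₀, hdm⟩ := Nat.exists_prime_and_dvd (n := m) (by
      rintro rfl
      exact h0 (by rw [hm, mul_one]))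
    have hq₀ : q ≠ p₀ := by
      rintro rfl
      exact hsq (by rw [hm, pow_two]; exact mul_dvd_mul_left _ hdm)
    have hd₀ : p₀ ∣ n₀ := hm ▸ hdm.mul_left _
    by_cases h1 : n₁ = 1
    · obtain ⟨p₂, hp₂, hd₂⟩ := Nat.exists_prime_and_dvd (n := n₂) (by tauto)
      have hr' : n₀ * n₂ * n₁ = n₀ * n₁ * n₂ := by ring
      have h' := h.swap.rotate
      have := h'.hasSmallDeriv_of_three_primes hq hp₀ hp₂ (hr' ▸ hqn) hd₀ hd₂ hq₀
        (hne₂ hp₂ hd₂) (by rwa [hr']) hC₀ hC₂ hC₁ hY hYq (by rwa [hr'])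
      exact ((this.rotate h').rotate h'.rotate).swap
    · obtain ⟨p₁, hp₁, hd₁⟩ := Nat.exists_prime_and_dvd (n := n₁) h1
      exact h.hasSmallDeriv_of_three_primes hq hp₀ hp₁ hqn hd₀ hd₁ hq₀
        (hne₁ hp₁ hd₁) hv hC₀ hC₁ hC₂ hY hYq hcard

/-- The case where all prime factors are small. -/
lemma SignedTriple.hasSmallDeriv_of_small_primes (h : SignedTriple n₀ n₁ n₂ e₀ e₁ e₂)
    {C X Z : ℕ} (h₀ : n₀ ≠ 1) (h₁ : n₁ ≠ 1) (hC₀ : n₀ ≤ C) (hC₁ : n₁ ≤ C) (hC₂ : n₂ ≤ C)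
    (hX : 1 ≤ X) (hZ : ∀ p ∈ (n₀ * n₁ * n₂).primeFactors, p ≤ Z)
    (hcard : 2 * (C * Nat.log 2 (n₀ * n₁ * n₂)) + 1 < X *
      ∏ p ∈ (n₀ * n₁ * n₂).primeFactors with ¬ p ∣ (n₀ * n₁ * n₂).factorization p, p) :
    HasSmallDeriv n₀ n₁ n₂ e₀ e₁ e₂ (Z * X) := by
  obtain ⟨p₀, hp₀, hd₀⟩ := Nat.exists_prime_and_dvd h₀
  obtain ⟨p₁, hp₁, hd₁⟩ := Nat.exists_prime_and_dvd h₁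
  have hn0 : n₀ * n₁ * n₂ ≠ 0 := mul_ne_zero (mul_ne_zero h.pos₀ h.pos₁) h.pos₂
  have h01 : p₀ ≠ p₁ := by
    rintro rfl
    exact Nat.not_coprime_of_dvd_of_dvd hp₀.one_lt hd₀ hd₁ h.cop₀₁
  have hm₀ := Nat.mem_primeFactors.2 ⟨hp₀, (hd₀.mul_right n₁).mul_right n₂, hn0⟩
  have hm₁ := Nat.mem_primeFactors.2 ⟨hp₁, (hd₁.mul_left n₀).mul_right n₂, hn0⟩
  set n := n₀ * n₁ * n₂ with hn
  -- Lengthening two sides by X multiplies the number of points by X², but the bound on the form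
  -- only by X.
  let N : ℕ → ℕ := fun p =>
    if p = p₀ ∨ p = p₁ then p * X else if p ∣ n.factorization p then 1 else p
  have hNX : ∀ p ∈ n.primeFactors, N p ≤ p * X := fun p hp => by
    have := (Nat.prime_of_mem_primeFactors hp).pos
    simp only [N]
    split_ifs <;> nlinarith
  refine h.hasSmallDeriv hp₀ hp₁ hd₀ hd₁ hC₀ hC₁ hC₂ (X := X) N hNX
    (fun p hp => (hNX p hp).trans (by gcongr; exact hZ p hp)) (fun p hp hp0 hp1 => ?_) ?_
  · simp only [N, hp0, hp1, or_self, if_false]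
    split_ifs with hv
    · exact Or.inl rfl
    · exact Or.inr ⟨le_rfl, hv⟩
  · have hprod : X * X * ∏ p ∈ n.primeFactors with ¬ p ∣ n.factorization p, p ≤
        ∏ p ∈ n.primeFactors, N p := by
      calc _ = ∏ p ∈ n.primeFactors, (if p = p₀ then X else 1) * (if p = p₁ then X else 1) *
            (if ¬ p ∣ n.factorization p then p else 1) := by
            rw [Finset.prod_mul_distrib, Finset.prod_mul_distrib, Finset.prod_ite_eq',
              Finset.prod_ite_eq', if_pos hm₀, if_pos hm₁, Finset.prod_filter]
        _ ≤ _ := by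
            refine Finset.prod_le_prod' fun p hp => ?_
            have hp1 := (Nat.prime_of_mem_primeFactors hp).pos
            by_cases c0 : p = p₀
            · have c1 : p ≠ p₁ := c0 ▸ h01
              simp only [N, c0, true_or, if_true, h01, if_false]
              rw [c0] at hp1
              split_ifs <;> nlinarith
            · by_cases c1 : p = p₁
              · simp only [N, c1, or_true, if_true, Ne.symm h01, if_false]
                rw [c1] at hp1
                split_ifs <;> nlinarith
              · simp only [N, c0, c1, or_self, if_false]
                split_ifs <;> simp
    refine lt_of_lt_of_le ?_ hprod
    calc 2 * (C * X * Nat.log 2 n) + 1 ≤ X * (2 * (C * Nat.log 2 n) + 1) := by nlinarith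
      _ < X * (X * ∏ p ∈ n.primeFactors with ¬ p ∣ n.factorization p, p) := by gcongr
      _ = _ := by ring

end

/-! ### Radical estimates, and abc implies small derivatives -/

/-- The primes dividing their own exponent contribute little to the radical. -/
lemma exists_radical_le_prod_mul {n : ℕ} (hn : n ≠ 0) (K : ℕ) :
    ∃ B : ℕ, B ^ K ≤ n ∧ radical n ≤
      (∏ p ∈ n.primeFactors with ¬ p ∣ n.factorization p, p) * primorial K * B := by
  set S := n.primeFactors.filter fun p => p ∣ n.factorization p with hS
  -- A prime p > K dividing its own exponent has exponent at least p > K; those up to K are covered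
  -- by the primorial.
  refine ⟨∏ p ∈ S with ¬ p ≤ K, p, ?_, ?_⟩
  · rw [← Finset.prod_pow]
    calc ∏ p ∈ S with ¬ p ≤ K, p ^ K ≤ ∏ p ∈ S with ¬ p ≤ K, p ^ n.factorization p := by
          refine Finset.prod_le_prod' fun p hp => ?_
          obtain ⟨hpS, hpK⟩ := Finset.mem_filter.1 hp
          obtain ⟨hpn, hpd⟩ := Finset.mem_filter.1 hpS
          have hpp := Nat.prime_of_mem_primeFactors hpn
          have := Nat.le_of_dvd
            (hpp.factorization_pos_of_dvd hn (Nat.dvd_of_mem_primeFactors hpn)) hpd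
          exact Nat.pow_le_pow_right hpp.pos (by omega)
      _ ≤ ∏ p ∈ n.primeFactors, p ^ n.factorization p := by
          refine Finset.prod_le_prod_of_subset_of_one_le'
            ((Finset.filter_subset _ _).trans (Finset.filter_subset _ _)) fun p hp _ => ?_
          exact Nat.one_le_pow _ _ (Nat.prime_of_mem_primeFactors hp).pos
      _ = n := Nat.prod_factorization_pow_eq_self hn
  · rw [Nat.radical_eq_prod_primeFactors,
      ← Finset.prod_filter_mul_prod_filter_not n.primeFactors (fun p => p ∣ n.factorization p),
      ← Finset.prod_filter_mul_prod_filter_not S (fun p => p ≤ K), mul_comm, mul_assoc]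
    gcongr
    refine Finset.prod_le_prod_of_subset_of_one_le' (fun p hp => ?_) fun p hp _ => ?_
    · obtain ⟨hpS, hpK⟩ := Finset.mem_filter.1 hp
      have hpp := Nat.prime_of_mem_primeFactors (Finset.mem_filter.1 hpS).1
      exact Finset.mem_filter.2 ⟨Finset.mem_range.2 (by omega), hpp⟩
    · exact (Finset.mem_filter.1 hp).2.pos

lemma IsABCTriple.signedTriple {a b c : ℕ} (h : IsABCTriple a b c) :
    SignedTriple a b c 1 1 (-1) := by
  obtain ⟨h1, h2, h3⟩ := abcTriple_coprime h
  obtain ⟨ha, hb, hc, -, habc⟩ := h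
  exact ⟨ha.ne', hb.ne', hc.ne', h1, h2, h3, by simp, by simp, by simp, by
    rw [← habc]; push_cast; ring⟩

lemma IsABCTriple.exists_mem_TPair {a b c Y : ℕ} (h : IsABCTriple a b c)
    (hY : HasSmallDeriv a b c 1 1 (-1) Y) :
    ∃ ψ ∈ TPair (a : ℤ) (b : ℤ), Independent ψ a b ∧ derivNorm ψ ≤ Y := by
  obtain ⟨x, hx0, hxY, hrel, hne⟩ := hY
  obtain ⟨ψ, hψ, hval⟩ := exists_linearMap_primeValues x fun p hp =>
    hx0 p fun h => hp (Nat.prime_of_mem_primeFactors h)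
  have habs : ∀ p : Primes, |((ψ (xi p) : ℤ) : ℝ)| ≤ Y := fun p => by
    rw [hψ]; exact_mod_cast hxY p
  have hc : (a : ℤ) + b = (c : ℕ) := by exact_mod_cast h.2.2.2.2
  refine ⟨ψ, ⟨⟨Y, ?_⟩, ?_, ?_⟩, ?_, ?_⟩
  · rintro _ ⟨p, rfl⟩
    exact habs p
  · intro p hp
    have h1 : (p : ℕ) ∣ a * b * c := by
      by_contra h1
      exact hp ((hψ p).trans (hx0 p fun h2 => h1 (Nat.dvd_of_mem_primeFactors h2)))
    change ((p : ℕ) : ℤ) ∣ _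
    rw [hc]
    exact_mod_cast h1
  · rw [hc, arithDeriv_natCast, arithDeriv_natCast, arithDeriv_natCast, hval]
    linarith
  · rw [Independent, wronskian, arithDeriv_natCast, arithDeriv_natCast, hval]
    exact sub_ne_zero.2 hne
  · have : Nonempty Primes := ⟨⟨2, Nat.prime_two⟩⟩
    exact ciSup_le habs

/-- The member divisible by q is rotated to the front. Then c ≥ 3 prevents the other two from both
being 1, and the exclusion of (1,N,q) covers the case where that member is q itself. -/
lemma IsABCTriple.exists_of_large_prime {a b c q Y : ℕ} (h : IsABCTriple a b c) (hc : 3 ≤ c)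
    (hne : ¬ IsOneNPrime a b c) (hq : q.Prime) (hqd : q ∣ a * b * c)
    (hCq : c < q ^ 2) (hY : 1 ≤ Y) (hYq : Y ≤ q)
    (hcard : 2 * (c * Nat.log 2 (a * b * c)) + 1 < Y ^ 2) :
    HasSmallDeriv a b c 1 1 (-1) Y := by
  have ht := h.signedTriple
  have habc : a + b = c := h.2.2.2.2
  have h1 : b * c * a = a * b * c := by ring
  have h2 : c * a * b = a * b * c := by ring
  have comm : ∀ x y z : ℕ, ({x, y, z} : Multiset ℕ) = {y, x, z} := fun x y z =>
    Multiset.cons_swap x y {z}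
  have comm' : ∀ x y z : ℕ, ({x, y, z} : Multiset ℕ) = {x, z, y} := fun x y z =>
    congrArg (x ::ₘ ·) (Multiset.cons_swap y z 0)
  rcases hq.dvd_mul.1 hqd with h3 | h3
  · rcases hq.dvd_mul.1 h3 with h3 | h3
    · refine ht.hasSmallDeriv_of_large_prime hq h3 (by omega) (by omega) le_rfl hCq hY hYq hcard
        (by omega) ?_
      rintro ⟨rfl, h4 | h4⟩
      · subst h4
        exact hne ⟨c, a, hq, by rw [comm, comm']⟩
      · omega
    · have := ht.rotate.hasSmallDeriv_of_large_prime hq h3 (by omega) le_rfl (by omega) hCq hY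
        hYq (by rwa [h1]) (by omega) (by
          rintro ⟨rfl, h4 | h4⟩
          · omega
          · subst h4
            exact hne ⟨c, b, hq, by rw [comm']⟩)
      exact (this.rotate ht.rotate).rotate ht.rotate.rotate
  · have := ht.rotate.rotate.hasSmallDeriv_of_large_prime hq h3 le_rfl (by omega) (by omega) hCq hY
      hYq (by rwa [h2]) (by omega) (by
        rintro ⟨rfl, h4 | h4⟩
        · subst h4
          exact hne ⟨b, c, hq, rfl⟩
        · subst h4
          exact hne ⟨a, c, hq, by rw [comm]⟩)
    exact this.rotate ht.rotate.rotate

/-- As c ≥ 3, both c and one of a, b exceed 1; these two are rotated to the front. -/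
lemma IsABCTriple.exists_of_small_primes {a b c X Z : ℕ} (h : IsABCTriple a b c) (hc : 3 ≤ c)
    (hX : 1 ≤ X) (hZ : ∀ p ∈ (a * b * c).primeFactors, p ≤ Z)
    (hcard : 2 * (c * Nat.log 2 (a * b * c)) + 1 < X *
      ∏ p ∈ (a * b * c).primeFactors with ¬ p ∣ (a * b * c).factorization p, p) :
    HasSmallDeriv a b c 1 1 (-1) (Z * X) := by
  have ht := h.signedTriple
  have habc : a + b = c := h.2.2.2.2
  have h1 : b * c * a = a * b * c := by ring
  have h2 : c * a * b = a * b * c := by ring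
  by_cases hb : b = 1
  · have := ht.rotate.rotate.hasSmallDeriv_of_small_primes (Z := Z) (by omega) (by omega)
      le_rfl (by omega) (by omega) hX (by rwa [h2]) (by rwa [h2])
    exact this.rotate ht.rotate.rotate
  · have := ht.rotate.hasSmallDeriv_of_small_primes (Z := Z) hb (by omega)
      (by omega) le_rfl (by omega) hX (by rwa [h1]) (by rwa [h1])
    exact (this.rotate ht.rotate).rotate ht.rotate.rotate

lemma eventually_mul_rpow_lt_rpow (A : ℝ) {s t : ℝ} (h : s < t) :
    ∀ᶠ n : ℕ in atTop, A * (n : ℝ) ^ s < (n : ℝ) ^ t := by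
  have h1 := ((tendsto_rpow_atTop (sub_pos.2 h)).comp
    tendsto_natCast_atTop_atTop).eventually_gt_atTop A
  filter_upwards [h1, eventually_gt_atTop 0] with n hn hn0
  have hn0' : (0 : ℝ) < n := by exact_mod_cast hn0
  calc A * (n : ℝ) ^ s < (n : ℝ) ^ (t - s) * (n : ℝ) ^ s := by
        gcongr
        exact hn
    _ = _ := by rw [← Real.rpow_add hn0']; congr 1; ring

lemma IsABCTriple.mul_le {a b c : ℕ} (h : IsABCTriple a b c) : a * b * c ≤ c ^ 3 := by
  have habc : a + b = c := h.2.2.2.2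
  calc a * b * c ≤ c * c * c := by gcongr <;> omega
    _ = _ := by ring

/-- A lower bound for the part of the radical coming from primes not dividing their exponent. -/
lemma MasserOesterleABC.exists_le_prod (h : MasserOesterleABC) :
    ∃ κ : ℝ, 0 < κ ∧ ∀ a b c : ℕ, IsABCTriple a b c → κ * (c : ℝ) ^ (0.8 : ℝ) ≤
      ((∏ p ∈ (a * b * c).primeFactors with ¬ p ∣ (a * b * c).factorization p, p : ℕ) : ℝ) := by
  -- With 1 / (1 + ε) = 0.9 the radical is at least of order c^0.9. The cutoff 30 below gives B ≤
  -- (c³)^(1/30) = c^0.1, leaving c^0.8.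
  obtain ⟨κ, hκ, hκ'⟩ := h (1 / 9) (by norm_num)
  have hP : (0 : ℝ) < primorial 30 := by exact_mod_cast primorial_pos 30
  refine ⟨(κ ^ (0.9 : ℝ) * primorial 30)⁻¹, by positivity, fun a b c habc => ?_⟩
  have hc0 : (0 : ℝ) < c := by exact_mod_cast habc.2.2.1
  have hn0 : a * b * c ≠ 0 :=
    mul_ne_zero (mul_ne_zero habc.1.ne' habc.2.1.ne') habc.2.2.1.ne'
  obtain ⟨B, hB, hBR⟩ := exists_radical_le_prod_mul hn0 30
  have hR0 : (0 : ℝ) ≤ (radical (a * b * c) : ℕ) := Nat.cast_nonneg _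
  set G := ∏ p ∈ (a * b * c).primeFactors with ¬ p ∣ (a * b * c).factorization p, p
  have h1 : (c : ℝ) ^ (0.9 : ℝ) ≤ κ ^ (0.9 : ℝ) * (radical (a * b * c) : ℕ) := by
    have h2 := Real.rpow_le_rpow hc0.le (hκ' a b c habc).le (show (0 : ℝ) ≤ 0.9 by norm_num)
    rw [Real.mul_rpow hκ.le (by positivity), ← Real.rpow_mul hR0] at h2
    norm_num at h2 ⊢
    exact h2
  have h2 : (B : ℝ) ≤ (c : ℝ) ^ (0.1 : ℝ) := by
    have h3 : (B : ℝ) ^ 30 ≤ ((c : ℝ) ^ (0.1 : ℝ)) ^ 30 := by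
      rw [← Real.rpow_natCast ((c : ℝ) ^ (0.1 : ℝ)), ← Real.rpow_mul hc0.le]
      norm_num
      exact_mod_cast hB.trans habc.mul_le
    exact le_of_pow_le_pow_left₀ (by norm_num) (by positivity) h3
  have h3 : ((radical (a * b * c) : ℕ) : ℝ) ≤ G * primorial 30 * (c : ℝ) ^ (0.1 : ℝ) := by
    calc ((radical (a * b * c) : ℕ) : ℝ) ≤ ((G * primorial 30 * B : ℕ) : ℝ) := by
          exact_mod_cast hBR
      _ ≤ _ := by push_cast; gcongr
  rw [inv_mul_le_iff₀ (by positivity)]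
  refine le_of_mul_le_mul_right (a := (c : ℝ) ^ (0.1 : ℝ)) ?_ (by positivity)
  calc (c : ℝ) ^ (0.8 : ℝ) * (c : ℝ) ^ (0.1 : ℝ) = (c : ℝ) ^ (0.9 : ℝ) := by
        rw [← Real.rpow_add hc0]; norm_num
    _ ≤ κ ^ (0.9 : ℝ) * (G * primorial 30 * (c : ℝ) ^ (0.1 : ℝ)) := h1.trans (by gcongr)
    _ = _ := by ring

/-- The Masser–Oesterlé `abc` conjecture implies the Small Derivatives Conjecture. -/
theorem smallDerivatives_of_masserOesterleABC (h : MasserOesterleABC) :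
    SmallDerivativesConjecture := by
  obtain ⟨κ, hκ, hG⟩ := h.exists_le_prod
  -- As abc ≤ c³, this exponent bounds log₂(abc) by K c^0.025.
  obtain ⟨K, hK0, hK⟩ := exists_log_le_rpow (δ := 1 / 120) (by norm_num)
  -- In order: the large-prime count, with Z ≥ c^0.6 / 2; the small-prime count, where X times the
  -- product is at least κ c^1.05; the norm bound Z X ≤ 2 c^0.85; and 2 < c^0.6, so that rounding
  -- down to Z loses less than half.
  have ev := ((eventually_mul_rpow_lt_rpow (4 * (2 * K + 1)) (s := 1.025) (t := 1.2)
    (by norm_num)).and <| (eventually_mul_rpow_lt_rpow ((2 * K + 1) / κ) (s := 1.025) (t := 1.05)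
    (by norm_num)).and <| (eventually_mul_rpow_lt_rpow 2 (s := 0.85) (t := 0.9)
    (by norm_num)).and <| (eventually_mul_rpow_lt_rpow 2 (s := 0) (t := 0.6)
    (by norm_num)).and (eventually_ge_atTop 3))
  obtain ⟨C, hC⟩ := eventually_atTop.1 ev
  refine ⟨0.9, by norm_num, by norm_num, (Set.finite_Iic (C, C, C)).subset ?_⟩
  rintro ⟨a, b, c⟩ ⟨habc, hne, hex⟩
  simp only at habc hne hex
  have hsum : a + b = c := habc.2.2.2.2
  by_cases hcC : c ≤ C
  · exact ⟨(by omega : a ≤ C), (by omega : b ≤ C), hcC⟩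
  exfalso
  apply hex
  obtain ⟨E1, E2, E3, E4, E5⟩ := hC c (by omega)
  have hc1 : (1 : ℝ) ≤ c := by exact_mod_cast (by omega : 1 ≤ c)
  have hc0 : (0 : ℝ) < c := by linarith
  have hL : ((2 * (c * Nat.log 2 (a * b * c)) + 1 : ℕ) : ℝ) ≤
      (2 * K + 1) * (c : ℝ) ^ (1.025 : ℝ) := by
    have h1 : (Nat.log 2 (a * b * c) : ℝ) ≤ K * (c : ℝ) ^ (0.025 : ℝ) := by
      refine (hK _).trans ?_
      have h2 : (((a * b * c : ℕ) : ℝ)) ≤ (c : ℝ) ^ (3 : ℕ) := by exact_mod_cast habc.mul_le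
      have h3 := Real.rpow_le_rpow (Nat.cast_nonneg _) h2 (show (0 : ℝ) ≤ 1 / 120 by norm_num)
      rw [← Real.rpow_natCast (c : ℝ) 3, ← Real.rpow_mul hc0.le,
        show ((3 : ℕ) : ℝ) * (1 / 120) = 0.025 by norm_num] at h3
      gcongr
    have h2 : (c : ℝ) * (c : ℝ) ^ (0.025 : ℝ) = (c : ℝ) ^ (1.025 : ℝ) := by
      conv_lhs => rw [← Real.rpow_one_add' hc0.le (by norm_num)]
      norm_num
    have h3 : (1 : ℝ) ≤ (c : ℝ) ^ (1.025 : ℝ) := Real.one_le_rpow hc1 (by norm_num)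
    push_cast
    calc 2 * ((c : ℝ) * Nat.log 2 (a * b * c)) + 1
        ≤ 2 * (c * (K * (c : ℝ) ^ (0.025 : ℝ))) + (c : ℝ) ^ (1.025 : ℝ) := by gcongr
      _ = (2 * K) * (c * (c : ℝ) ^ (0.025 : ℝ)) + (c : ℝ) ^ (1.025 : ℝ) := by ring
      _ = _ := by rw [h2]; ring
  set Z := ⌊(c : ℝ) ^ (0.6 : ℝ)⌋₊ with hZdef
  have hZle : (Z : ℝ) ≤ (c : ℝ) ^ (0.6 : ℝ) := Nat.floor_le (by positivity)
  have hZlt : (c : ℝ) ^ (0.6 : ℝ) < Z + 1 := Nat.lt_floor_add_one _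
  rw [Real.rpow_zero] at E4
  suffices hY : ∃ Y : ℕ, HasSmallDeriv a b c 1 1 (-1) Y ∧ (Y : ℝ) < (c : ℝ) ^ (0.9 : ℝ) by
    obtain ⟨Y, hY, hlt⟩ := hY
    obtain ⟨ψ, hψ, hind, hn⟩ := habc.exists_mem_TPair hY
    exact ⟨ψ, hψ, hind, hn.trans_lt hlt⟩
  have h85 : (c : ℝ) ^ (0.6 : ℝ) ≤ (c : ℝ) ^ (0.85 : ℝ) :=
    Real.rpow_le_rpow_of_exponent_le hc1 (by norm_num)
  by_cases hlarge : ∃ q ∈ (a * b * c).primeFactors, Z < q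
  · obtain ⟨q, hq, hZq⟩ := hlarge
    have hcq : (c : ℝ) ^ (0.6 : ℝ) < q := hZlt.trans_le (by exact_mod_cast hZq)
    have h12 : ((c : ℝ) ^ (0.6 : ℝ)) ^ 2 = (c : ℝ) ^ (1.2 : ℝ) := by
      rw [← Real.rpow_natCast, ← Real.rpow_mul hc0.le]; norm_num
    refine ⟨Z, habc.exists_of_large_prime E5 hne (Nat.prime_of_mem_primeFactors hq)
      (Nat.dvd_of_mem_primeFactors hq) ?_ ?_ hZq.le ?_, ?_⟩
    · have : (c : ℝ) < (q : ℝ) ^ 2 := by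
        calc (c : ℝ) = (c : ℝ) ^ (1 : ℝ) := (Real.rpow_one _).symm
          _ ≤ (c : ℝ) ^ (1.2 : ℝ) := Real.rpow_le_rpow_of_exponent_le hc1 (by norm_num)
          _ = ((c : ℝ) ^ (0.6 : ℝ)) ^ 2 := h12.symm
          _ < _ := by gcongr
      exact_mod_cast this
    · have : (0 : ℝ) < Z := by linarith
      exact_mod_cast this
    · have : ((2 * (c * Nat.log 2 (a * b * c)) + 1 : ℕ) : ℝ) < ((Z ^ 2 : ℕ) : ℝ) := by
        push_cast at hL ⊢
        have h4 : (c : ℝ) ^ (0.6 : ℝ) ≤ 2 * Z := by linarith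
        have h5 : (c : ℝ) ^ (1.2 : ℝ) ≤ (2 * Z) ^ 2 := by rw [← h12]; gcongr
        nlinarith
      exact_mod_cast this
    · have : (0 : ℝ) < (c : ℝ) ^ (0.85 : ℝ) := by positivity
      linarith
  · push Not at hlarge
    set X := ⌈(c : ℝ) ^ (0.25 : ℝ)⌉₊ with hXdef
    have hXle : (c : ℝ) ^ (0.25 : ℝ) ≤ X := Nat.le_ceil _
    have hXlt : (X : ℝ) < (c : ℝ) ^ (0.25 : ℝ) + 1 := Nat.ceil_lt_add_one (by positivity)
    have h25 : (1 : ℝ) ≤ (c : ℝ) ^ (0.25 : ℝ) := Real.one_le_rpow hc1 (by norm_num)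
    refine ⟨Z * X, habc.exists_of_small_primes E5 ?_ hlarge ?_, ?_⟩
    · exact_mod_cast h25.trans hXle
    · rw [div_mul_eq_mul_div, div_lt_iff₀ hκ] at E2
      have : (c : ℝ) ^ (1.05 : ℝ) * κ ≤ X *
          ((∏ p ∈ (a * b * c).primeFactors with ¬ p ∣ (a * b * c).factorization p, p : ℕ) : ℝ) := by
        calc (c : ℝ) ^ (1.05 : ℝ) * κ = (c : ℝ) ^ (0.25 : ℝ) * (κ * (c : ℝ) ^ (0.8 : ℝ)) := by
              rw [mul_left_comm, ← Real.rpow_add hc0, mul_comm]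
              norm_num
          _ ≤ _ := mul_le_mul hXle (hG a b c habc) (by positivity) (by positivity)
      have h4 := (hL.trans_lt E2).trans_le this
      exact_mod_cast h4
    · have h4 : (c : ℝ) ^ (0.6 : ℝ) * (c : ℝ) ^ (0.25 : ℝ) = (c : ℝ) ^ (0.85 : ℝ) := by
        rw [← Real.rpow_add hc0]; norm_num
      push_cast
      calc (Z : ℝ) * X ≤ (c : ℝ) ^ (0.6 : ℝ) * ((c : ℝ) ^ (0.25 : ℝ) + 1) := by gcongr
        _ ≤ (c : ℝ) ^ (0.6 : ℝ) * (2 * (c : ℝ) ^ (0.25 : ℝ)) := by gcongr; linarith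
        _ = 2 * (c : ℝ) ^ (0.85 : ℝ) := by rw [← h4]; ring
        _ < _ := E3

end SmallDerivatives

theorem corollary4 :
    (SmallDerivatives.MasserOesterleABC → SmallDerivatives.SmallDerivativesConjecture) ∧
      (SmallDerivatives.SmallDerivativesConjecture → SmallDerivatives.OesterleABC) :=
  ⟨SmallDerivatives.smallDerivatives_of_masserOesterleABC,
    SmallDerivatives.oesterleABC_of_smallDerivatives⟩
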